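/- Let $G$ be a Lie group, $H\subset G$ a closed subgroup, and $G/H$ the homogeneous manifold with base point $o=eH$ (its smooth structure is the one for which $\pi:G\to G/H$ is a submersion), with $\mathfrak g=T_eG$ and $\mathfrak h=\ker d\pi_e$. Let $\tilde a$ be a $G$-invariant Riemannian metric and $X$ a $G$-invariant smooth vector field on $G/H$. Let $b_0>0$ and let $\phi$ be a function which is positive and $C^\infty$ on $(-b_0,b_0)$ and satisfies $\phi(s)-s\phi'(s)+(b^2-s^2)\phi''(s)>0$ for $|s|\le b<b_0$; suppose $\sqrt{\tilde a(X,X)}<b_0$ everywhere. Let $F$ be the invariant $(\alpha,\beta)$-metric $$F(x,y)=\sqrt{\tilde a_x(y,y)}\;\phi(r),\qquad r=\frac{\tilde a_x(X(x),y)}{\sqrt{\tilde a_x(y,y)}}\quad(y\ne0),\qquad F(x,0)=0.$$ Let $\mathfrak g=\mathfrak h\oplus\mathfrak m$ be an $\mathrm{Ad}(H)$-invariant decomposition; write $[\cdot,\cdot]_{\mathfrak m}$ for the $\mathfrak m$-component of the bracket, identify $\mathfrak m$ with $T_o(G/H)$ via $d\pi_e$, and for $x\in\mathfrak g$ let $(\mathrm{ad}_x)_{\mathfrak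 m}:\mathfrak m\to\mathfrak m$ be $u\mapsto[x,u]_{\mathfrak m}$. For $y\ne0$ in $\mathfrak m$ put $$g_y(u,v)=\tfrac12\frac{\partial^2}{\partial s\,\partial t}F^2(y+su+tv)\Big|_{0},\qquad C_y(z,u,v)=\tfrac14\frac{\partial^3}{\partial s\,\partial t\,\partial h}F^2(y+sz+tu+hv)\Big|_{0}.$$ $F$ is called naturally reductive (in the sense of Latifi) with respect to $\mathfrak m$ if $$g_y([x,u]_{\mathfrak m},v)+g_y(u,[x,v]_{\mathfrak m})+2C_y([x,y]_{\mathfrak m},u,v)=0\qquad\text{for all }x,u,v,y\in\mathfrak m,\ y\neq0,$$ and $(G/H,F)$ is called naturally reductive if this holds for some $\mathrm{Ad}(H)$-invariant decomposition. Then: (I) If $(\mathrm{ad}_x)_{\mathfrak m}$ is skew-adjoint with respect to $\tilde a$ for every $x\in\mathfrak g$, and $\tilde a(X,[\mathfrak m,\mathfrak m]_{\mathfrak m})=0$, then $F$ is naturally reductive with respect to $\mathfrak m$; in particular $(G/H,F)$ is naturally reductive. (II) Conversely, suppose that $F$ is naturally reductive with respect to $\mathfrak m$, that the Chern connection of $F$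 coincides with the Levi-Civita connection of $\tilde a$, and that $\phi'(r)\neq0$ for $r=\tilde a(X,y)/\sqrt{\tilde a(y,y)}$ and every $0\ne y\in\mathfrak m$. Then $(\mathrm{ad}_x)_{\mathfrak m}$ is skew-adjoint with respect to $\tilde a$ for every $x\in\mathfrak g$, and $\tilde a(X,[\mathfrak m,\mathfrak m]_{\mathfrak m})=0$. -/

import Mathlib

open scoped Manifold ContDiff

noncomputable section

/-! ## Minkowski norms: fundamental tensor and Cartan tensor -/

/-- The fundamental tensor `g_y(u, v) = (1/2) ∂²/∂s∂t f²(y + s u + t v)` at `s = t = 0` of a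
function `f` on a real vector space. -/
def fundamentalTensor {V : Type*} [AddCommGroup V] [Module ℝ V] (f : V → ℝ) (y u v : V) : ℝ :=
  (1 / 2 : ℝ) * deriv (fun s : ℝ => deriv (fun t : ℝ => f (y + s • u + t • v) ^ 2) 0) 0

/-- The Cartan tensor `C_y(z, u, v) = (1/4) ∂³/∂s∂t∂h f²(y + s z + t u + h v)` at
`s = t = h = 0` of a function `f` on a real vector space. -/
def cartanTensor {V : Type*} [AddCommGroup V] [Module ℝ V] (f : V → ℝ) (y z u v : V) : ℝ :=
  (1 / 4 : ℝ) * deriv (fun s : ℝ => deriv (fun t : ℝ => deriv (fun h : ℝ =>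
    f (y + s • z + t • u + h • v) ^ 2) 0) 0) 0

/-! ## (α, β)-metrics on a manifold -/

section Manifold

variable {V : Type*} [NormedAddCommGroup V] [NormedSpace ℝ V]
  {M : Type*} [TopologicalSpace M] [ChartedSpace V M] [IsManifold 𝓘(ℝ, V) ∞ M]

variable (V M) in
/-- Smooth Riemannian metrics on the manifold `M`. -/
abbrev SmoothRiemannianMetric : Type _ :=
  Bundle.ContMDiffRiemannianMetric 𝓘(ℝ, V) ∞ V (fun x : M => TangentSpace 𝓘(ℝ, V) x)

/-- The function `φ` is positive and smooth on `(-b₀, b₀)`, with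
`φ(s) - s φ'(s) + (b² - s²) φ''(s) > 0` whenever `|s| ≤ b < b₀`. -/
structure IsAlphaBetaProfile (φ : ℝ → ℝ) (b₀ : ℝ) : Prop where
  b₀_pos : 0 < b₀
  smooth : ContDiffOn ℝ ∞ φ (Set.Ioo (-b₀) b₀)
  pos : ∀ s ∈ Set.Ioo (-b₀) b₀, 0 < φ s
  convex : ∀ s b : ℝ, |s| ≤ b → b < b₀ →
    0 < φ s - s * deriv φ s + (b ^ 2 - s ^ 2) * deriv (deriv φ) s

/-- The quantity `r = a(X, y) / √(a(y, y))`. -/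
def alphaBetaRatio (a : SmoothRiemannianMetric V M) (X : (x : M) → TangentSpace 𝓘(ℝ, V) x)
    (x : M) (y : TangentSpace 𝓘(ℝ, V) x) : ℝ :=
  a.inner x (X x) y / √(a.inner x y y)

/-- The (α, β)-metric `F(x, y) = α(x, y) φ(a(X(x), y) / α(x, y))`, `α(x, y) = √(a_x(y, y))`. Its
value at `y = 0` is `0`. -/
def alphaBetaMetric (φ : ℝ → ℝ) (a : SmoothRiemannianMetric V M)
    (X : (x : M) → TangentSpace 𝓘(ℝ, V) x) (x : M) (y : TangentSpace 𝓘(ℝ, V) x) : ℝ :=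
  √(a.inner x y y) * φ (alphaBetaRatio a X x y)

/-! ## The Chern connection and the Levi-Civita connection in charts -/

/-- The expression of `F : TM → ℝ` in the chart `e`. -/
def chartFinsler (F : (x : M) → TangentSpace 𝓘(ℝ, V) x → ℝ) (e : OpenPartialHomeomorph M V)
    (x : V) (y : V) : ℝ :=
  F (e.symm x) (mfderiv 𝓘(ℝ, V) 𝓘(ℝ, V) e.symm x y)

/-- The expression of the Riemannian metric `a` in the chart `e`. -/
def chartMetric (a : SmoothRiemannianMetric V M) (e : OpenPartialHomeomorph M V)
    (x : V) (u v : V) : ℝ :=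
  a.inner (e.symm x) (mfderiv 𝓘(ℝ, V) 𝓘(ℝ, V) e.symm x u)
    (mfderiv 𝓘(ℝ, V) 𝓘(ℝ, V) e.symm x v)

/-- `Γ` is the value at `x` of the Christoffel symbols of the Levi-Civita connection of `a` in the
chart `e`: it is torsion-free and compatible with the metric. -/
structure IsLeviCivitaChristoffel (a : SmoothRiemannianMetric V M)
    (e : OpenPartialHomeomorph M V) (x : V) (Γ : V →ₗ[ℝ] V →ₗ[ℝ] V) : Prop where
  symm : ∀ u v : V, Γ u v = Γ v u
  compatible : ∀ w u v : V, fderiv ℝ (fun x' : V => chartMetric a e x' u v) x w =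
    chartMetric a e x (Γ w u) v + chartMetric a e x u (Γ w v)

/-- `Γ` is the value at `(x, y)` of the Christoffel symbols of the Chern connection of `F` in the
chart `e`: it is torsion-free and almost compatible with the fundamental tensor,
`δg_{ij}/δx^k = g_{lj} Γ^l_{ik} + g_{il} Γ^l_{jk}`, with `δ/δx^k = ∂/∂x^k - N^l_k ∂/∂y^l`,
`N^l_k = Γ^l_{kj} y^j` and `∂g_{ij}/∂y^l = 2 C_{ijl}`. -/
structure IsChernChristoffel (F : (x : M) → TangentSpace 𝓘(ℝ, V) x → ℝ)
    (e : OpenPartialHomeomorph M V) (x y : V) (Γ : V →ₗ[ℝ] V →ₗ[ℝ] V) : Prop where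
  symm : ∀ u v : V, Γ u v = Γ v u
  almost_compatible : ∀ w u v : V,
    fderiv ℝ (fun x' : V => fundamentalTensor (chartFinsler F e x') y u v) x w
        - 2 * cartanTensor (chartFinsler F e x) y (Γ w y) u v =
      fundamentalTensor (chartFinsler F e x) y (Γ w u) v
        + fundamentalTensor (chartFinsler F e x) y u (Γ w v)

/-- The Chern connection of `F` and the Levi-Civita connection of `a` coincide: in every chart of
the atlas they have the same Christoffel symbols (those of the Chern connection at `(x, y)` then
do not depend on the direction `y`). -/
def ChernEqLeviCivita (F : (x : M) → TangentSpace 𝓘(ℝ, V) x → ℝ)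
    (a : SmoothRiemannianMetric V M) : Prop :=
  ∀ e ∈ atlas V M, ∀ x ∈ e.target, ∃ Γ : V →ₗ[ℝ] V →ₗ[ℝ] V,
    IsLeviCivitaChristoffel a e x Γ ∧ ∀ y : V, y ≠ 0 → IsChernChristoffel F e x y Γ

end Manifold

/-! ## Homogeneous manifolds -/

section Homogeneous

variable {E : Type*} [NormedAddCommGroup E] [NormedSpace ℝ E]
  {G : Type*} [Group G] [TopologicalSpace G] [ChartedSpace E G]
  {V : Type*} [NormedAddCommGroup V] [NormedSpace ℝ V]

variable (E) in
/-- The adjoint action of `g` on the Lie algebra: the differential at `1` of `x ↦ g x g⁻¹`. -/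
def adjointAction (g : G) (v : GroupLieAlgebra 𝓘(ℝ, E) G) : GroupLieAlgebra 𝓘(ℝ, E) G :=
  mfderiv 𝓘(ℝ, E) 𝓘(ℝ, E) (fun x : G => g * x * g⁻¹) 1 v

variable (E V) in
/-- The manifold structure given on the quotient `G ⧸ H` is that of the homogeneous manifold:
the one for which the projection `G → G ⧸ H` is a smooth submersion. -/
structure IsHomogeneousManifold (H : Subgroup G) [ChartedSpace V (G ⧸ H)] : Prop where
  contMDiff_mk : ContMDiff 𝓘(ℝ, E) 𝓘(ℝ, V) ∞ (QuotientGroup.mk : G → G ⧸ H)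
  surjective_mfderiv_mk : ∀ g : G, Function.Surjective
    (mfderiv 𝓘(ℝ, E) 𝓘(ℝ, V) (QuotientGroup.mk : G → G ⧸ H) g)

variable (E V) in
/-- The differential at `1` of the projection `G → G ⧸ H`, from the Lie algebra of `G` to the
tangent space of `G ⧸ H` at the base point. -/
def projDifferential (H : Subgroup G) [ChartedSpace V (G ⧸ H)] :
    GroupLieAlgebra 𝓘(ℝ, E) G →ₗ[ℝ] TangentSpace 𝓘(ℝ, V) (QuotientGroup.mk (1 : G) : G ⧸ H) :=
  (mfderiv 𝓘(ℝ, E) 𝓘(ℝ, V) (QuotientGroup.mk : G → G ⧸ H) 1).toLinearMap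

variable (E V) in
/-- The Lie algebra of `H` as a subspace of the Lie algebra of `G`: the tangent space at `1` of the
fibre `H` of the projection `G → G ⧸ H`, that is, the kernel of its differential. -/
def isotropyAlgebra (H : Subgroup G) [ChartedSpace V (G ⧸ H)] :
    Submodule ℝ (GroupLieAlgebra 𝓘(ℝ, E) G) :=
  LinearMap.ker (projDifferential E V H)

variable {H : Subgroup G} [ChartedSpace V (G ⧸ H)] [IsManifold 𝓘(ℝ, V) ∞ (G ⧸ H)]

/-- Invariance of a Riemannian metric under the action of `G` on `G ⧸ H`. -/
def IsInvariantMetric (a : SmoothRiemannianMetric V (G ⧸ H)) : Prop :=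
  ∀ (g : G) (x : G ⧸ H) (u v : TangentSpace 𝓘(ℝ, V) x),
    a.inner (g • x) (mfderiv 𝓘(ℝ, V) 𝓘(ℝ, V) (fun p : G ⧸ H => g • p) x u)
      (mfderiv 𝓘(ℝ, V) 𝓘(ℝ, V) (fun p : G ⧸ H => g • p) x v) = a.inner x u v

/-- Invariance of a vector field under the action of `G` on `G ⧸ H`. -/
def IsInvariantField (X : (x : G ⧸ H) → TangentSpace 𝓘(ℝ, V) x) : Prop :=
  ∀ (g : G) (x : G ⧸ H),
    mfderiv 𝓘(ℝ, V) 𝓘(ℝ, V) (fun p : G ⧸ H => g • p) x (X x) = X (g • x)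

variable (E V H) in
/-- An `Ad(H)`-invariant decomposition `𝔤 = 𝔥 ⊕ 𝔪`. -/
structure ReductiveDecomposition where
  m : Submodule ℝ (GroupLieAlgebra 𝓘(ℝ, E) G)
  isCompl : IsCompl m (isotropyAlgebra E V H)
  invariant : ∀ h ∈ H, ∀ v ∈ m, adjointAction E h v ∈ m

namespace ReductiveDecomposition

/-- The `𝔪`-component `[x, y]_𝔪` of the bracket, for the decomposition `𝔤 = 𝔥 ⊕ 𝔪`. -/
def bracketM (D : ReductiveDecomposition E V H) (x y : GroupLieAlgebra 𝓘(ℝ, E) G) : D.m :=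
  Submodule.projectionOnto D.m (isotropyAlgebra E V H) D.isCompl ⁅x, y⁆

/-- The identification of `𝔪` with the tangent space of `G ⧸ H` at the base point. -/
def toTangent (D : ReductiveDecomposition E V H) (y : D.m) :
    TangentSpace 𝓘(ℝ, V) (QuotientGroup.mk (1 : G) : G ⧸ H) :=
  projDifferential E V H y

/-- The function induced on `𝔪` by a Finsler metric on `G ⧸ H`. -/
def inducedNorm (D : ReductiveDecomposition E V H)
    (F : (x : G ⧸ H) → TangentSpace 𝓘(ℝ, V) x → ℝ) (y : D.m) : ℝ :=
  F (QuotientGroup.mk (1 : G)) (D.toTangent y)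

/-- The bilinear form induced on `𝔪` by a Riemannian metric on `G ⧸ H`. -/
def inducedInner (D : ReductiveDecomposition E V H) (a : SmoothRiemannianMetric V (G ⧸ H))
    (u v : D.m) : ℝ :=
  a.inner (QuotientGroup.mk (1 : G)) (D.toTangent u) (D.toTangent v)

/-- The Finsler metric `F` on `G ⧸ H` is naturally reductive (in the sense of Latifi) with respect
to the decomposition `𝔤 = 𝔥 ⊕ 𝔪`:
`g_y([x, u]_𝔪, v) + g_y(u, [x, v]_𝔪) + 2 C_y([x, y]_𝔪, u, v) = 0` for `y ≠ 0`, `x`, `u`, `v` in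
`𝔪`. -/
def NaturallyReductive (D : ReductiveDecomposition E V H)
    (F : (x : G ⧸ H) → TangentSpace 𝓘(ℝ, V) x → ℝ) : Prop :=
  ∀ y x u v : D.m, y ≠ 0 →
    fundamentalTensor (D.inducedNorm F) y (D.bracketM x u) v
      + fundamentalTensor (D.inducedNorm F) y u (D.bracketM x v)
      + 2 * cartanTensor (D.inducedNorm F) y (D.bracketM x y) u v = 0

/-- Every `(ad_x)_𝔪 : 𝔪 → 𝔪`, `u ↦ [x, u]_𝔪`, with `x ∈ 𝔤`, is skew-adjoint for `a`. -/
def AdSkewAdjoint (D : ReductiveDecomposition E V H)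
    (a : SmoothRiemannianMetric V (G ⧸ H)) : Prop :=
  ∀ (x : GroupLieAlgebra 𝓘(ℝ, E) G) (u v : D.m),
    D.inducedInner a (D.bracketM x u) v = -D.inducedInner a u (D.bracketM x v)

/-- The condition `a(X, [𝔪, 𝔪]_𝔪) = 0` at the base point. -/
def OrthogonalToBrackets (D : ReductiveDecomposition E V H)
    (a : SmoothRiemannianMetric V (G ⧸ H)) (X : (x : G ⧸ H) → TangentSpace 𝓘(ℝ, V) x) : Prop :=
  ∀ u v : D.m, a.inner (QuotientGroup.mk (1 : G)) (X (QuotientGroup.mk (1 : G)))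
    (D.toTangent (D.bracketM u v)) = 0

end ReductiveDecomposition

variable (E) in
/-- The Finsler metric `F` on `G ⧸ H` is naturally reductive in the sense of Latifi: it is so with
respect to some `Ad(H)`-invariant decomposition of the Lie algebra. -/
def IsNaturallyReductive (F : (x : G ⧸ H) → TangentSpace 𝓘(ℝ, V) x → ℝ) : Prop :=
  ∃ D : ReductiveDecomposition E V H, D.NaturallyReductive F

end Homogeneous

end

/-! Put `L = F²` on `𝔪`, and let `A = (ad_x)_𝔪`. The left side of Latifi's condition is half the
second derivative, in `u` and `v`, of the function `w ↦ dL_w(A w)` at `y`. Moreover `dL_y(v) = 2F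
((φ - rφ') a(y,v)/α + φ' a(X,v))`. (I) If `A` is skew and `a(X, A·) = 0`, then `dL_w(A w)` vanishes
identically, and so does its Hessian (`fderiv_two_invariant`). (II) Taking `u = v = y`, Euler's
relation for the 2-homogeneous `L` reduces the condition to `dL_y(A y) = 0`. For `y ⟂ X` its two
terms have opposite parity in `y`, and for `y = X` the `φ'` terms cancel; hence `a(X, A·) = 0`. Then
`φ - rφ' > 0` gives `a(y, A y) = 0` (`skew_of_alphaBetaNorm_infinitesimally_invariant`). This covers
`x ∈ 𝔪`. For `x ∈ 𝔥`, skewness comes from the invariance of the metric: left-invariant fields on `G`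
have constant products for its pullback, and this is differentiated along the vertical field of `x`
(`inner_bracket_isotropy`). -/

noncomputable section

/-! ### Second and third derivatives of the square of a norm. -/

section Minkowski

variable {V : Type*} [NormedAddCommGroup V] [NormedSpace ℝ V]

open Topology Filter

/-- A directional derivative along a line. -/
lemma deriv_line {W : Type*} [NormedAddCommGroup W] [NormedSpace ℝ W] {L : V → W} {y : V}
    (hL : DifferentiableAt ℝ L y) (v : V) :
    deriv (fun t : ℝ => L (y + t • v)) 0 = fderiv ℝ L y v := by
  have h1 : HasDerivAt (fun t : ℝ => y + t • v) v 0 := by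
    simpa using ((hasDerivAt_id (0 : ℝ)).smul_const v).const_add y
  have h2 : HasFDerivAt L (fderiv ℝ L y) (y + (0 : ℝ) • v) := by simpa using hL.hasFDerivAt
  exact (h2.comp_hasDerivAt (0 : ℝ) h1).deriv

lemma tendsto_line (y v : V) : Tendsto (fun t : ℝ => y + t • v) (𝓝 0) (𝓝 y) := by
  have : Continuous (fun t : ℝ => y + t • v) := by fun_prop
  simpa using this.tendsto 0

/-- Replaces iterated one-variable derivatives by Fréchet derivatives, whose symmetry is then
available. -/
lemma fundamentalTensor_eq_fderiv {f : V → ℝ} {y : V} (hf : ContDiffAt ℝ 2 (fun w => f w ^ 2) y)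
    (u v : V) :
    fundamentalTensor f y u v =
      (1 / 2 : ℝ) * fderiv ℝ (fderiv ℝ (fun w => f w ^ 2)) y u v := by
  set L : V → ℝ := fun w => f w ^ 2 with hLdef
  have h1 : ∀ᶠ w in 𝓝 y, DifferentiableAt ℝ L w :=
    (hf.eventually (by simp)).mono fun w hw => hw.differentiableAt (by simp)
  have h2 : DifferentiableAt ℝ (fderiv ℝ L) y :=
    (hf.fderiv_right (m := 1) (by norm_num)).differentiableAt (by simp)
  have h3 : (fun s : ℝ => deriv (fun t : ℝ => f (y + s • u + t • v) ^ 2) 0) =ᶠ[𝓝 0]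
      fun s : ℝ => fderiv ℝ L (y + s • u) v := by
    filter_upwards [(tendsto_line y u).eventually h1] with s hs
    exact deriv_line hs v
  have h4 : DifferentiableAt ℝ (fun w => fderiv ℝ L w v) y := by fun_prop
  rw [fundamentalTensor, h3.deriv_eq, deriv_line h4 u]
  congr 1
  rw [fderiv_clm_apply h2 (by fun_prop)]
  simp

/-- The two inner derivatives are twice the fundamental tensor at `y + s z`, so only one derivative
along `z` remains. -/
lemma cartanTensor_eq_fderiv {f : V → ℝ} {y : V} (hf : ContDiffAt ℝ 3 (fun w => f w ^ 2) y)
    (z u v : V) :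
    cartanTensor f y z u v =
      (1 / 4 : ℝ) * fderiv ℝ (fderiv ℝ (fderiv ℝ (fun w => f w ^ 2))) y z u v := by
  have h0 : ∀ᶠ w in 𝓝 y, ContDiffAt ℝ 3 (fun w => f w ^ 2) w := hf.eventually (by simp)
  have h2 : ContDiffAt ℝ 1 (fderiv ℝ (fderiv ℝ (fun w => f w ^ 2))) y :=
    (hf.fderiv_right (m := 2) (by norm_num)).fderiv_right (by norm_num)
  have h2' := h2.differentiableAt (by simp)
  have h3 : (fun s : ℝ => deriv (fun t : ℝ => deriv (fun h : ℝ =>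
      f (y + s • z + t • u + h • v) ^ 2) 0) 0) =ᶠ[𝓝 0]
      fun s : ℝ => fderiv ℝ (fderiv ℝ (fun w => f w ^ 2)) (y + s • z) u v := by
    filter_upwards [(tendsto_line y z).eventually h0] with s hs
    have := fundamentalTensor_eq_fderiv (hs.of_le (by norm_num)) u v
    rw [fundamentalTensor] at this
    linarith
  have h4 : DifferentiableAt ℝ
      (fun w => fderiv ℝ (fderiv ℝ (fun w => f w ^ 2)) w u v) y := by fun_prop
  rw [cartanTensor, h3.deriv_eq,
    deriv_line (L := fun w => fderiv ℝ (fderiv ℝ (fun w => f w ^ 2)) w u v) h4 z]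
  congr 1
  rw [fderiv_clm_apply (by fun_prop) (by fun_prop), fderiv_clm_apply h2' (by fun_prop)]
  simp

/-- The third derivative is symmetric in its last two arguments. -/
lemma fderiv_three_symm_right {L : V → ℝ} {y : V} (hL : ContDiffAt ℝ 3 L y) (u v w : V) :
    fderiv ℝ (fderiv ℝ (fderiv ℝ L)) y u v w = fderiv ℝ (fderiv ℝ (fderiv ℝ L)) y u w v := by
  have h2 : DifferentiableAt ℝ (fderiv ℝ (fderiv ℝ L)) y :=
    ((hL.fderiv_right (m := 2) (by norm_num)).fderiv_right (m := 1) (by norm_num)).differentiableAt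
      (by simp)
  have h3 : (fun p => fderiv ℝ (fderiv ℝ L) p v w) =ᶠ[𝓝 y]
      fun p => fderiv ℝ (fderiv ℝ L) p w v := by
    filter_upwards [hL.eventually (by simp)] with p hp
    exact (hp.isSymmSndFDerivAt (by simp; norm_num)).eq v w
  have h4 := congrArg (fun T : V →L[ℝ] ℝ => T u) h3.fderiv_eq
  rw [fderiv_clm_apply (by fun_prop) (by fun_prop), fderiv_clm_apply h2 (by fun_prop),
    fderiv_clm_apply (by fun_prop) (by fun_prop), fderiv_clm_apply h2 (by fun_prop)] at h4
  simpa using h4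

/-- The third derivative is symmetric in its first two arguments. -/
lemma fderiv_three_symm_left {L : V → ℝ} {y : V} (hL : ContDiffAt ℝ 3 L y) (u v w : V) :
    fderiv ℝ (fderiv ℝ (fderiv ℝ L)) y u v w = fderiv ℝ (fderiv ℝ (fderiv ℝ L)) y v u w := by
  rw [((hL.fderiv_right (m := 2) (by norm_num)).isSymmSndFDerivAt (by simp)).eq u v]

/-- If `L` is infinitesimally invariant under the linear vector field `A`, then so is its
second derivative. -/
lemma fderiv_two_invariant {L : V → ℝ} {y : V} (hL : ContDiffAt ℝ 3 L y) (A : V →L[ℝ] V)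
    (hA : ∀ᶠ w in 𝓝 y, fderiv ℝ L w (A w) = 0) (u v : V) :
    fderiv ℝ (fderiv ℝ L) y (A u) v + fderiv ℝ (fderiv ℝ L) y u (A v)
      + fderiv ℝ (fderiv ℝ (fderiv ℝ L)) y (A y) u v = 0 := by
  -- The hypothesis differentiated along `v`; differentiating again along `u` gives the claim up to
  -- the order of arguments.
  have h1 : ∀ᶠ w in 𝓝 y, fderiv ℝ (fderiv ℝ L) w v (A w) + fderiv ℝ L w (A v) = 0 := by
    filter_upwards [hA.eventually_nhds, hL.eventually (by simp)] with w hw hLw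
    have hd : DifferentiableAt ℝ (fderiv ℝ L) w :=
      (hLw.fderiv_right (m := 2) (by norm_num)).differentiableAt (by simp)
    have h : (fun w => fderiv ℝ L w (A w)) =ᶠ[𝓝 w] fun _ => (0 : ℝ) := hw
    have h' := congrArg (fun T : V →L[ℝ] ℝ => T v) h.fderiv_eq
    rw [fderiv_clm_apply hd (by fun_prop)] at h'
    simpa [add_comm] using h'
  have hd : DifferentiableAt ℝ (fderiv ℝ L) y :=
    (hL.fderiv_right (m := 2) (by norm_num)).differentiableAt (by simp)
  have hd2 : DifferentiableAt ℝ (fderiv ℝ (fderiv ℝ L)) y :=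
    ((hL.fderiv_right (m := 2) (by norm_num)).fderiv_right (m := 1) (by norm_num)).differentiableAt
      (by simp)
  have h : (fun w => fderiv ℝ (fderiv ℝ L) w v (A w) + fderiv ℝ L w (A v)) =ᶠ[𝓝 y]
      fun _ => (0 : ℝ) := h1
  have h' := congrArg (fun T : V →L[ℝ] ℝ => T u) h.fderiv_eq
  rw [fderiv_fun_add (by fun_prop) (by fun_prop), fderiv_clm_apply (by fun_prop) (by fun_prop),
    fderiv_clm_apply hd2 (by fun_prop), fderiv_clm_apply hd (by fun_prop)] at h'
  simp at h'
  rw [fderiv_three_symm_left hL, fderiv_three_symm_right hL,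
    ((hL.of_le (by norm_num)).isSymmSndFDerivAt (n := 2) (by simp)).eq (A u) v]
  linarith

/-- Euler's relation for functions that are positively homogeneous of degree two, twice
differentiated. -/
lemma fderiv_three_eq_zero_of_homogeneous {L : V → ℝ} {y : V} (hL : ContDiffAt ℝ 3 L y)
    (hE : ∀ᶠ w in 𝓝 y, fderiv ℝ L w w = 2 * L w) (z u : V) :
    fderiv ℝ (fderiv ℝ L) y z y = fderiv ℝ L y z ∧
      fderiv ℝ (fderiv ℝ (fderiv ℝ L)) y u z y = 0 := by
  -- Euler's relation differentiated along `z`. In its derivative along `u` the two second-order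
  -- terms cancel by symmetry.
  have h1 : ∀ᶠ w in 𝓝 y, fderiv ℝ (fderiv ℝ L) w z w = fderiv ℝ L w z := by
    filter_upwards [hE.eventually_nhds, hL.eventually (by simp)] with w hw hLw
    have hd : DifferentiableAt ℝ (fderiv ℝ L) w :=
      (hLw.fderiv_right (m := 2) (by norm_num)).differentiableAt (by simp)
    have h : (fun w => fderiv ℝ L w w) =ᶠ[𝓝 w] fun w => 2 * L w := hw
    have h' := congrArg (fun T : V →L[ℝ] ℝ => T z) h.fderiv_eq
    rw [fderiv_clm_apply hd (by fun_prop), fderiv_const_mul (hLw.differentiableAt (by simp))] at h'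
    simp at h'
    linarith
  refine ⟨h1.self_of_nhds, ?_⟩
  have hd : DifferentiableAt ℝ (fderiv ℝ L) y :=
    (hL.fderiv_right (m := 2) (by norm_num)).differentiableAt (by simp)
  have hd2 : DifferentiableAt ℝ (fderiv ℝ (fderiv ℝ L)) y :=
    ((hL.fderiv_right (m := 2) (by norm_num)).fderiv_right (m := 1) (by norm_num)).differentiableAt
      (by simp)
  have h : (fun w => fderiv ℝ (fderiv ℝ L) w z w) =ᶠ[𝓝 y] fun w => fderiv ℝ L w z := h1
  have h' := congrArg (fun T : V →L[ℝ] ℝ => T u) h.fderiv_eq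
  rw [fderiv_clm_apply (by fun_prop) (by fun_prop),
    fderiv_clm_apply hd2 (by fun_prop), fderiv_clm_apply hd (by fun_prop)] at h'
  simp at h'
  have := ((hL.of_le (by norm_num)).isSymmSndFDerivAt (n := 2) (by simp)).eq z u
  linarith

end Minkowski

/-! ### (α, β)-norms on a vector space and their linear symmetries. -/

section AlphaBetaNorm

variable {V : Type*} [NormedAddCommGroup V] [NormedSpace ℝ V]
  {q : V →L[ℝ] V →L[ℝ] ℝ} {ξ : V} {φ : ℝ → ℝ} {b₀ : ℝ}

open Topology Filter

/-- Cauchy–Schwarz; it keeps `β / α` inside the interval where `φ` is smooth and positive. -/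
lemma abs_ratio_le (hs : ∀ u v, q u v = q v u) (hp : ∀ v, v ≠ 0 → 0 < q v v) (y : V) :
    |q ξ y / √(q y y)| ≤ √(q ξ ξ) := by
  have hnn : ∀ v, 0 ≤ q v v := fun v => by
    rcases eq_or_ne v 0 with rfl | hv
    · simp
    · exact (hp v hv).le
  rcases eq_or_ne y 0 with rfl | hy
  · simp
  have hcs : q ξ y * q y ξ ≤ q ξ ξ * q y y :=
    LinearMap.BilinForm.apply_mul_apply_le_of_forall_zero_le
      (LinearMap.mk₂ ℝ (fun u v => q u v) (by simp) (by simp) (by simp) (by simp)) hnn ξ y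
  rw [hs y ξ, ← sq] at hcs
  have hpos : 0 < √(q y y) := Real.sqrt_pos.2 (hp y hy)
  rw [abs_div, abs_of_pos hpos, div_le_iff₀ hpos, ← Real.sqrt_mul (hnn ξ)]
  exact Real.abs_le_sqrt hcs

variable (q ξ φ) in
/-- The `(α, β)`-norm `α φ(β / α)` on a vector space, with `α² = q` and `β = q(ξ, ·)`. -/
def alphaBetaNorm (y : V) : ℝ := √(q y y) * φ (q ξ y / √(q y y))

lemma ratio_mem (hs : ∀ u v, q u v = q v u) (hp : ∀ v, v ≠ 0 → 0 < q v v)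
    (hb : √(q ξ ξ) < b₀) (y : V) : q ξ y / √(q y y) ∈ Set.Ioo (-b₀) b₀ :=
  abs_lt.1 ((abs_ratio_le hs hp y).trans_lt hb)

lemma contDiffAt_alphaBetaNorm_sq (hφ : IsAlphaBetaProfile φ b₀) (hs : ∀ u v, q u v = q v u)
    (hp : ∀ v, v ≠ 0 → 0 < q v v) (hb : √(q ξ ξ) < b₀) {y : V} (hy : y ≠ 0) :
    ContDiffAt ℝ 3 (fun w => alphaBetaNorm q ξ φ w ^ 2) y := by
  have h1 : ContDiffAt ℝ 3 (fun w => q w w) y := by fun_prop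
  have h2 : ContDiffAt ℝ 3 (fun w => √(q w w)) y := h1.sqrt (hp y hy).ne'
  have h3 : ContDiffAt ℝ 3 (fun w => q ξ w / √(q w w)) y :=
    ContDiffAt.div (by fun_prop) h2 (Real.sqrt_pos.2 (hp y hy)).ne'
  have h4 : ContDiffAt ℝ 3 φ (q ξ y / √(q y y)) :=
    contDiffAt_infty.1 (hφ.smooth.contDiffAt (isOpen_Ioo.mem_nhds (ratio_mem hs hp hb y))) 3
  exact (h2.mul (h4.comp y h3)).pow 2

/-- The differential of the square of an `(α, β)`-norm. -/
lemma fderiv_alphaBetaNorm_sq (hφ : IsAlphaBetaProfile φ b₀) (hs : ∀ u v, q u v = q v u)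
    (hp : ∀ v, v ≠ 0 → 0 < q v v) (hb : √(q ξ ξ) < b₀) {y : V} (hy : y ≠ 0) (v : V) :
    fderiv ℝ (fun w => alphaBetaNorm q ξ φ w ^ 2) y v =
      2 * alphaBetaNorm q ξ φ y *
        ((φ (q ξ y / √(q y y)) - q ξ y / √(q y y) * deriv φ (q ξ y / √(q y y)))
            * (q y v / √(q y y)) + deriv φ (q ξ y / √(q y y)) * q ξ v) := by
  have hα : 0 < √(q y y) := Real.sqrt_pos.2 (hp y hy)
  have h0 : HasDerivAt (fun t : ℝ => y + t • v) v 0 := by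
    simpa using ((hasDerivAt_id (0 : ℝ)).smul_const v).const_add y
  have h1 : HasDerivAt (fun t : ℝ => q (y + t • v) (y + t • v)) (2 * q y v) 0 := by
    have e : (fun t : ℝ => q (y + t • v) (y + t • v)) =
        fun t => q y y + 2 * q y v * t + q v v * t ^ 2 := by
      funext t; simp [hs v y]; ring
    rw [e]
    have := (((hasDerivAt_id (0 : ℝ)).const_mul (2 * q y v)).const_add (q y y)).add
      (((hasDerivAt_id (0 : ℝ)).pow 2).const_mul (q v v))
    convert! this using 1
    simp
  have h2 : HasDerivAt (fun t : ℝ => √(q (y + t • v) (y + t • v))) (q y v / √(q y y)) 0 := by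
    convert! h1.sqrt (by simpa using (hp y hy).ne') using 1
    simp
    field_simp
  have h3 : HasDerivAt (fun t : ℝ => q ξ (y + t • v)) (q ξ v) 0 :=
    (q ξ).hasFDerivAt.comp_hasDerivAt 0 h0
  have h4 := h3.div h2 (by simpa using hα.ne')
  have hm := ratio_mem hs hp hb y
  have h5 : HasDerivAt φ (deriv φ (q ξ y / √(q y y)))
      (q ξ (y + (0 : ℝ) • v) / √(q (y + (0 : ℝ) • v) (y + (0 : ℝ) • v))) := by
    simpa using ((hφ.smooth.contDiffAt (isOpen_Ioo.mem_nhds hm)).differentiableAt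
      (by simp)).hasDerivAt
  have h6 := (h2.mul (h5.comp (0 : ℝ) h4)).pow 2
  rw [← deriv_line ((contDiffAt_alphaBetaNorm_sq hφ hs hp hb hy).differentiableAt (by simp)) v]
  refine (h6.deriv).trans ?_
  simp only [alphaBetaNorm, Pi.mul_apply, Pi.div_apply, Function.comp_apply, zero_smul, add_zero]
  generalize √(q y y) = α at *
  field_simp
  ring

lemma fderiv_alphaBetaNorm_sq_self (hφ : IsAlphaBetaProfile φ b₀) (hs : ∀ u v, q u v = q v u)
    (hp : ∀ v, v ≠ 0 → 0 < q v v) (hb : √(q ξ ξ) < b₀) {y : V} (hy : y ≠ 0) :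
    fderiv ℝ (fun w => alphaBetaNorm q ξ φ w ^ 2) y y = 2 * alphaBetaNorm q ξ φ y ^ 2 := by
  rw [fderiv_alphaBetaNorm_sq hφ hs hp hb hy]
  have hα : 0 < √(q y y) := Real.sqrt_pos.2 (hp y hy)
  have hα2 : √(q y y) ^ 2 = q y y := Real.sq_sqrt (hp y hy).le
  simp only [alphaBetaNorm]
  -- The sixth occurrence of `q y y` is the numerator coming from `q y v` at `v = y`; the earlier
  -- ones are under square roots.
  nth_rewrite 6 [← hα2]
  field_simp
  ring

/-- An `(α, β)`-norm is invariant under a linear vector field that is skew for `α` and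
annihilated by `β`. -/
theorem alphaBetaNorm_infinitesimally_invariant [FiniteDimensional ℝ V]
    (hφ : IsAlphaBetaProfile φ b₀) (hs : ∀ u v, q u v = q v u)
    (hp : ∀ v, v ≠ 0 → 0 < q v v) (hb : √(q ξ ξ) < b₀) (A : V →ₗ[ℝ] V)
    (hA : ∀ y, q y (A y) = 0) (hξ : ∀ y, q ξ (A y) = 0) {y : V} (hy : y ≠ 0) (u v : V) :
    fundamentalTensor (alphaBetaNorm q ξ φ) y (A u) v
      + fundamentalTensor (alphaBetaNorm q ξ φ) y u (A v)
      + 2 * cartanTensor (alphaBetaNorm q ξ φ) y (A y) u v = 0 := by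
  have h3 := contDiffAt_alphaBetaNorm_sq hφ hs hp hb hy
  rw [fundamentalTensor_eq_fderiv (h3.of_le (by norm_num)),
    fundamentalTensor_eq_fderiv (h3.of_le (by norm_num)), cartanTensor_eq_fderiv h3]
  have := fderiv_two_invariant h3 (LinearMap.toContinuousLinearMap A) (by
    filter_upwards [isOpen_ne.mem_nhds hy] with w hw
    rw [fderiv_alphaBetaNorm_sq hφ hs hp hb hw]
    simp [hA, hξ]) u v
  simp only [LinearMap.coe_toContinuousLinearMap'] at this
  linarith

/-- Conversely, if `φ'` does not vanish on the values of `β / α`, a linear vector field that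
leaves an `(α, β)`-norm invariant is skew for `α` and annihilated by `β`. -/
theorem skew_of_alphaBetaNorm_infinitesimally_invariant
    (hφ : IsAlphaBetaProfile φ b₀) (hs : ∀ u v, q u v = q v u)
    (hp : ∀ v, v ≠ 0 → 0 < q v v) (hb : √(q ξ ξ) < b₀) (A : V →ₗ[ℝ] V)
    (hA : ∀ y, y ≠ 0 → ∀ u v, fundamentalTensor (alphaBetaNorm q ξ φ) y (A u) v
      + fundamentalTensor (alphaBetaNorm q ξ φ) y u (A v)
      + 2 * cartanTensor (alphaBetaNorm q ξ φ) y (A y) u v = 0)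
    (hφ' : ∀ y, y ≠ 0 → deriv φ (q ξ y / √(q y y)) ≠ 0) :
    (∀ y, q y (A y) = 0) ∧ ∀ y, q ξ (A y) = 0 := by
  have hN : ∀ y, y ≠ 0 → 0 < alphaBetaNorm q ξ φ y := fun y hy =>
    mul_pos (Real.sqrt_pos.2 (hp y hy)) (hφ.pos _ (ratio_mem hs hp hb y))
  -- The condition at `u = v = y`: the Cartan term vanishes and the other two each equal `dL_y(A y)
  -- / 2`. The factor `2F` is then cancelled.
  have key : ∀ y, y ≠ 0 →
      (φ (q ξ y / √(q y y)) - q ξ y / √(q y y) * deriv φ (q ξ y / √(q y y)))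
        * (q y (A y) / √(q y y)) + deriv φ (q ξ y / √(q y y)) * q ξ (A y) = 0 := by
    intro y hy
    have h3 := contDiffAt_alphaBetaNorm_sq hφ hs hp hb hy
    have h := hA y hy y y
    rw [fundamentalTensor_eq_fderiv (h3.of_le (by norm_num)),
      fundamentalTensor_eq_fderiv (h3.of_le (by norm_num)), cartanTensor_eq_fderiv h3,
      fderiv_three_symm_right h3, (fderiv_three_eq_zero_of_homogeneous h3 (by
        filter_upwards [isOpen_ne.mem_nhds hy] with w hw
        exact fderiv_alphaBetaNorm_sq_self hφ hs hp hb hw) y (A y)).2,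
      ((h3.of_le (by norm_num)).isSymmSndFDerivAt (n := 2) (by simp)).eq y (A y),
      (fderiv_three_eq_zero_of_homogeneous h3 (by
        filter_upwards [isOpen_ne.mem_nhds hy] with w hw
        exact fderiv_alphaBetaNorm_sq_self hφ hs hp hb hw) (A y) y).1,
      fderiv_alphaBetaNorm_sq hφ hs hp hb hy] at h
    have hpos := hN y hy
    refine (mul_eq_zero.1 (?_ : alphaBetaNorm q ξ φ y * _ = 0)).resolve_left hpos.ne'
    linarith
  have hξA : ∀ y, q ξ (A y) = 0 := by
    -- Here `r = 0`. Under `y ↦ -y` the term in `q y (A y)` is even and the term in `q ξ (A y)` is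
    -- odd, so `φ'(0) q ξ (A y) = 0`.
    have hperp : ∀ y, q ξ y = 0 → q ξ (A y) = 0 := by
      intro y hy0
      rcases eq_or_ne y 0 with rfl | hy
      · simp
      have h1 := key y hy
      have h2 := key (-y) (neg_ne_zero.2 hy)
      have h3 := hφ' y hy
      simp only [map_neg, neg_apply, neg_neg, hy0, neg_zero, zero_div, zero_mul, sub_zero]
        at h1 h2 h3
      have h4 : deriv φ 0 * q ξ (A y) = 0 := by
        simp at h2
        linarith
      exact (mul_eq_zero.1 h4).resolve_left h3
    intro y
    rcases eq_or_ne ξ 0 with rfl | hξ0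
    · simp
    have hξξ := hp ξ hξ0
    -- At `y = ξ` one has `r = α`, so the `φ'` terms cancel and a nonzero multiple of `φ(r) q ξ (A
    -- ξ)` is left.
    have h1 : q ξ (A ξ) = 0 := by
      have hα : 0 < √(q ξ ξ) := Real.sqrt_pos.2 hξξ
      have h := key ξ hξ0
      have hr : q ξ ξ / √(q ξ ξ) = √(q ξ ξ) := Real.div_sqrt
      rw [hr] at h
      have hφp := hφ.pos _ (hr ▸ ratio_mem hs hp hb ξ)
      have h' : φ √(q ξ ξ) * q ξ (A ξ) = 0 := by
        field_simp at h
        linarith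
      exact (mul_eq_zero.1 h').resolve_left hφp.ne'
    have h2 := hperp (y - (q ξ y / q ξ ξ) • ξ) (by simp [hξξ.ne'])
    simpa [h1] using h2
  refine ⟨fun y => ?_, hξA⟩
  rcases eq_or_ne y 0 with rfl | hy
  · simp
  have hα : 0 < √(q y y) := Real.sqrt_pos.2 (hp y hy)
  have h := key y hy
  have hm := ratio_mem hs hp hb y
  -- The choice `b = |r|` removes the `φ''` term, leaving `φ - rφ' > 0`.
  have hc := hφ.convex (q ξ y / √(q y y)) |q ξ y / √(q y y)| le_rfl (abs_lt.2 hm)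
  rw [sq_abs, sub_self, zero_mul, add_zero] at hc
  rw [hξA, mul_zero, add_zero] at h
  simpa [hα.ne'] using (mul_eq_zero.1 h).resolve_left hc.ne'

end AlphaBetaNorm

/-! ### Brackets with vertical vector fields, in coordinates. -/

section VectorSpaceBracket

open VectorField Topology Filter

variable {E W : Type*} [NormedAddCommGroup E] [NormedSpace ℝ E]
  [NormedAddCommGroup W] [NormedSpace ℝ W]

/-- If the vector field `Z` is vertical for `P`, the derivative in the direction `Z` of the
projection of `U` is the projection of `[Z, U]`. -/
lemma fderiv_apply_of_vertical {P : E → W} {Z U : E → E} {p : E} (hP : ContDiffAt ℝ 2 P p)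
    (hZ : DifferentiableAt ℝ Z p) (hU : DifferentiableAt ℝ U p)
    (hv : ∀ᶠ x in 𝓝 p, fderiv ℝ P x (Z x) = 0) :
    fderiv ℝ (fun x => fderiv ℝ P x (U x)) p (Z p) = fderiv ℝ P p (lieBracket ℝ Z U p) := by
  have hd : DifferentiableAt ℝ (fderiv ℝ P) p :=
    (hP.fderiv_right (m := 1) (by norm_num)).differentiableAt (by simp)
  have h : (fun x => fderiv ℝ P x (Z x)) =ᶠ[𝓝 p] fun _ => 0 := hv
  -- Differentiating `dP(Z) = 0` along `U` turns `-dP(DZ·U)` into `D²P(U, Z)`, which symmetry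
  -- matches with `D²P(Z, U)`.
  have h1 := congrArg (fun T : E →L[ℝ] W => T (U p)) h.fderiv_eq
  rw [fderiv_clm_apply hd hZ] at h1
  rw [fderiv_clm_apply hd hU, lieBracket]
  simp at h1
  have h2 := (hP.isSymmSndFDerivAt (n := 2) (by simp)).eq (Z p) (U p)
  simp only [add_apply, ContinuousLinearMap.comp_apply,
    ContinuousLinearMap.flip_apply, map_sub, h2]
  rw [eq_neg_of_add_eq_zero_right h1]
  abel

/-- If the pullback along `P` of a bilinear form is constant on the vector fields `U₁`, `U₂`, then
brackets with a vertical vector field `Z` act skew-symmetrically. -/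
lemma bilin_lieBracket_of_vertical {P : E → W} {Z U₁ U₂ : E → E} {p : E}
    (hP : ContDiffAt ℝ 2 P p) (hZ : DifferentiableAt ℝ Z p) (hU₁ : DifferentiableAt ℝ U₁ p)
    (hU₂ : DifferentiableAt ℝ U₂ p) (hv : ∀ᶠ x in 𝓝 p, fderiv ℝ P x (Z x) = 0)
    {B : W → W →L[ℝ] W →L[ℝ] ℝ} (hB : DifferentiableAt ℝ B (P p)) {c : ℝ}
    (hc : ∀ᶠ x in 𝓝 p, B (P x) (fderiv ℝ P x (U₁ x)) (fderiv ℝ P x (U₂ x)) = c) :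
    B (P p) (fderiv ℝ P p (lieBracket ℝ Z U₁ p)) (fderiv ℝ P p (U₂ p))
      + B (P p) (fderiv ℝ P p (U₁ p)) (fderiv ℝ P p (lieBracket ℝ Z U₂ p)) = 0 := by
  have hd : DifferentiableAt ℝ (fderiv ℝ P) p :=
    (hP.fderiv_right (m := 1) (by norm_num)).differentiableAt (by simp)
  have hPd : DifferentiableAt ℝ P p := hP.differentiableAt (by simp)
  have hBP : DifferentiableAt ℝ (fun x => B (P x)) p :=
    DifferentiableAt.comp (G := W →L[ℝ] W →L[ℝ] ℝ) p hB hPd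
  -- The coefficients of the form do not vary along `Z` to first order, as `dP(Z) = 0`.
  have hBP' : fderiv ℝ (fun x => B (P x)) p (Z p) = 0 := by
    have := fderiv_comp (G := W →L[ℝ] W →L[ℝ] ℝ) p hB hPd
    rw [Function.comp_def] at this
    rw [this, ContinuousLinearMap.comp_apply, hv.self_of_nhds, map_zero]
  have h : (fun x => B (P x) (fderiv ℝ P x (U₁ x)) (fderiv ℝ P x (U₂ x))) =ᶠ[𝓝 p] fun _ => c := hc
  have h1 := congrArg (fun T : E →L[ℝ] ℝ => T (Z p)) h.fderiv_eq
  rw [fderiv_clm_apply (hBP.clm_apply (hd.clm_apply hU₁)) (hd.clm_apply hU₂),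
    fderiv_clm_apply hBP (hd.clm_apply hU₁)] at h1
  simp only [add_apply, ContinuousLinearMap.comp_apply,
    ContinuousLinearMap.flip_apply, hBP', fderiv_apply_of_vertical hP hZ hU₁ hv,
    fderiv_apply_of_vertical hP hZ hU₂ hv] at h1
  simp at h1
  linarith

end VectorSpaceBracket

/-! ### The Riemannian metric read in a chart. -/

section ChartMetric

open Topology Filter

variable {V : Type*} [NormedAddCommGroup V] [NormedSpace ℝ V]
  {M : Type*} [TopologicalSpace M] [ChartedSpace V M] [IsManifold 𝓘(ℝ, V) ∞ M]

/-- A smooth Riemannian metric is differentiable when read in a chart. -/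
lemma exists_metric_in_chart (a : SmoothRiemannianMetric V M) (o : M) :
    ∃ B : V → V →L[ℝ] V →L[ℝ] ℝ, DifferentiableAt ℝ B (extChartAt 𝓘(ℝ, V) o o) ∧
      ∀ y ∈ (chartAt V o).source, ∀ u v : TangentSpace 𝓘(ℝ, V) y,
        B (extChartAt 𝓘(ℝ, V) o y) (mfderiv 𝓘(ℝ, V) 𝓘(ℝ, V) (extChartAt 𝓘(ℝ, V) o) y u)
          (mfderiv 𝓘(ℝ, V) 𝓘(ℝ, V) (extChartAt 𝓘(ℝ, V) o) y v) = a.inner y u v := by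
  let g : M → V →L[ℝ] V →L[ℝ] ℝ := fun y ↦
    ContinuousLinearMap.inCoordinates V (TangentSpace 𝓘(ℝ, V) (M := M)) (V →L[ℝ] ℝ)
      (fun x : M ↦ TangentSpace 𝓘(ℝ, V) x →L[ℝ] ℝ) o y o y (a.inner y)
  have hg : ContMDiffAt 𝓘(ℝ, V) 𝓘(ℝ, V →L[ℝ] V →L[ℝ] ℝ) ∞ g o := by
    have := a.contMDiff o
    rw [contMDiffAt_hom_bundle] at this
    exact this.2
  refine ⟨fun p => g ((extChartAt 𝓘(ℝ, V) o).symm p), ?_, ?_⟩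
  · have h1 := (contMDiffAt_iff_source (I := 𝓘(ℝ, V)) (x := o)).1 hg
    simp only [modelWithCornersSelf_coe, Set.range_id, contMDiffWithinAt_univ] at h1
    exact h1.contDiffAt.differentiableAt (by simp)
  · intro y hy u v
    have hb : y ∈ (trivializationAt V (TangentSpace 𝓘(ℝ, V)) o).baseSet := hy
    have hinv : (extChartAt 𝓘(ℝ, V) o).symm (extChartAt 𝓘(ℝ, V) o y) = y :=
      (extChartAt 𝓘(ℝ, V) o).left_inv (by simpa using hy)
    -- The trivialization of the tangent bundle over the chart is the differential of the chart, so
    -- its inverse undoes that differential.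
    have A : ∀ w : TangentSpace 𝓘(ℝ, V) y,
        (trivializationAt V (TangentSpace 𝓘(ℝ, V)) o).symm y
          (mfderiv 𝓘(ℝ, V) 𝓘(ℝ, V) (extChartAt 𝓘(ℝ, V) o) y w) = w := by
      intro w
      rw [← TangentBundle.continuousLinearMapAt_trivializationAt hy]
      convert! ((trivializationAt V (TangentSpace 𝓘(ℝ, V)) o).continuousLinearEquivAt
        ℝ _ hb).symm_apply_apply w
      simp [Bundle.Trivialization.coe_continuousLinearEquivAt_eq _ hb]
      rfl
    have hgy : ∀ w₁ w₂ : V, g y w₁ w₂ =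
        a.inner y ((trivializationAt V (TangentSpace 𝓘(ℝ, V)) o).symm y w₁)
          ((trivializationAt V (TangentSpace 𝓘(ℝ, V)) o).symm y w₂) := fun w₁ w₂ =>
      (inCoordinates_apply_eq₂ (F₃ := ℝ) (E₃ := Bundle.Trivial M ℝ) hb hb (Set.mem_univ _)).trans
        (by simp)
    simp only [hinv]
    exact (hgy _ _).trans (congrArg₂ (fun w₁ w₂ => a.inner y w₁ w₂) (A u) (A v))

end ChartMetric

/-! ### Skewness of the isotropy action, from invariance of the metric. -/

section Isotropy

open VectorField Topology Filter

variable {E : Type*} [NormedAddCommGroup E] [NormedSpace ℝ E]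
  {V : Type*} [NormedAddCommGroup V] [NormedSpace ℝ V]
  {G : Type*} [Group G] [TopologicalSpace G] [ChartedSpace E G] [LieGroup 𝓘(ℝ, E) ∞ G]
  {H : Subgroup G} [ChartedSpace V (G ⧸ H)] [IsManifold 𝓘(ℝ, V) ∞ (G ⧸ H)]

variable (E G) in
lemma lieGroup_minSmoothness : LieGroup 𝓘(ℝ, E) (minSmoothness ℝ 3) G :=
  LieGroup.of_le (n := ∞) (by simpa using ENat.LEInfty.out)

omit [LieGroup 𝓘(ℝ, E) ∞ G] [IsManifold 𝓘(ℝ, V) ∞ (G ⧸ H)] in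
lemma mdifferentiableAt_mk (hGH : IsHomogeneousManifold E V H) (g : G) :
    MDifferentiableAt 𝓘(ℝ, E) 𝓘(ℝ, V) (QuotientGroup.mk : G → G ⧸ H) g :=
  (hGH.contMDiff_mk g).mdifferentiableAt (by simp)

/-- An isometric action has nonzero differentials, hence is differentiable. -/
lemma mdifferentiableAt_smul_of_invariant {a : SmoothRiemannianMetric V (G ⧸ H)}
    (ha : IsInvariantMetric a) (g : G) (x : G ⧸ H) {u : TangentSpace 𝓘(ℝ, V) x} (hu : u ≠ 0) :
    MDifferentiableAt 𝓘(ℝ, V) 𝓘(ℝ, V) (fun p : G ⧸ H => g • p) x := by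
  by_contra h
  have h1 := ha g x u u
  rw [mfderiv_zero_of_not_mdifferentiableAt h] at h1
  have h2 := a.pos x u hu
  rw [← h1] at h2
  simp at h2

/-- The differential of the projection along left translates. -/
lemma mfderiv_mk_mul_left (hGH : IsHomogeneousManifold E V H)
    {a : SmoothRiemannianMetric V (G ⧸ H)} (ha : IsInvariantMetric a) (g : G)
    (w : GroupLieAlgebra 𝓘(ℝ, E) G) :
    (mfderiv 𝓘(ℝ, E) 𝓘(ℝ, V) (QuotientGroup.mk : G → G ⧸ H) (g * 1)
        (mfderiv 𝓘(ℝ, E) 𝓘(ℝ, E) (fun x : G => g * x) 1 w) :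
      TangentSpace 𝓘(ℝ, V) (g • (QuotientGroup.mk 1 : G ⧸ H))) =
      mfderiv 𝓘(ℝ, V) 𝓘(ℝ, V) (fun p : G ⧸ H => g • p) (QuotientGroup.mk 1)
        (projDifferential E V H w) := by
  by_cases hV : ∃ u : TangentSpace 𝓘(ℝ, V) (QuotientGroup.mk 1 : G ⧸ H), u ≠ 0
  · obtain ⟨u, hu⟩ := hV
    have h1 := mdifferentiableAt_smul_of_invariant ha g _ hu
    have h2 : MDifferentiableAt 𝓘(ℝ, E) 𝓘(ℝ, E) (fun x : G => g * x) 1 :=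
      (contMDiff_mul_left (I := 𝓘(ℝ, E)) (n := ∞) (a := g)).contMDiffAt.mdifferentiableAt (by simp)
    have e : (QuotientGroup.mk : G → G ⧸ H) ∘ (fun x : G => g * x) =
        (fun p : G ⧸ H => g • p) ∘ (QuotientGroup.mk : G → G ⧸ H) := rfl
    have h3 := mfderiv_comp (1 : G) (mdifferentiableAt_mk hGH (g * 1)) h2
    have h4 := mfderiv_comp (1 : G) h1 (mdifferentiableAt_mk hGH 1)
    exact congrArg (fun T : E →L[ℝ] V => T w) (h3.symm.trans h4)
  -- With zero tangent space, invariance says nothing about differentiability, but any two vectors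
  -- agree.
  · push Not at hV
    have h : ∀ u : V, u = 0 := hV
    exact (h _).trans (h _).symm

/-- Left-invariant vector fields have constant products for the pullback to `G` of an invariant
metric. -/
lemma inner_mulInvariantVectorField (hGH : IsHomogeneousManifold E V H)
    {a : SmoothRiemannianMetric V (G ⧸ H)} (ha : IsInvariantMetric a) (g : G)
    (u v : GroupLieAlgebra 𝓘(ℝ, E) G) :
    a.inner (QuotientGroup.mk g)
        (mfderiv 𝓘(ℝ, E) 𝓘(ℝ, V) (QuotientGroup.mk : G → G ⧸ H) g (mulInvariantVectorField u g))
        (mfderiv 𝓘(ℝ, E) 𝓘(ℝ, V) (QuotientGroup.mk : G → G ⧸ H) g (mulInvariantVectorField v g)) =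
      a.inner (QuotientGroup.mk 1) (projDifferential E V H u) (projDifferential E V H v) := by
  -- A variable `g'` replaces `g * 1`, whose tangent space is not definitionally indexed by `g`.
  have key : ∀ (g' : G) (h : g * 1 = g'), a.inner (QuotientGroup.mk g')
        (mfderiv 𝓘(ℝ, E) 𝓘(ℝ, V) (QuotientGroup.mk : G → G ⧸ H) g'
          (mfderiv 𝓘(ℝ, E) 𝓘(ℝ, E) (fun x : G => g * x) 1 u : E))
        (mfderiv 𝓘(ℝ, E) 𝓘(ℝ, V) (QuotientGroup.mk : G → G ⧸ H) g'
          (mfderiv 𝓘(ℝ, E) 𝓘(ℝ, E) (fun x : G => g * x) 1 v : E)) =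
      a.inner (QuotientGroup.mk 1) (projDifferential E V H u) (projDifferential E V H v) := by
    rintro g' rfl
    rw [← ha g (QuotientGroup.mk 1)]
    rw [← mfderiv_mk_mul_left hGH ha, ← mfderiv_mk_mul_left hGH ha]
    rfl
  exact key g (mul_one g)

/-- The projected vector has the same length at `g` as at the identity, where it is zero; positivity
of `a` concludes. -/
lemma mfderiv_mk_mulInvariantVectorField_eq_zero (hGH : IsHomogeneousManifold E V H)
    {a : SmoothRiemannianMetric V (G ⧸ H)} (ha : IsInvariantMetric a) (g : G)
    {x : GroupLieAlgebra 𝓘(ℝ, E) G} (hx : projDifferential E V H x = 0) :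
    mfderiv 𝓘(ℝ, E) 𝓘(ℝ, V) (QuotientGroup.mk : G → G ⧸ H) g (mulInvariantVectorField x g) = 0 := by
  by_contra h
  have h1 := a.pos _ _ h
  rw [inner_mulInvariantVectorField hGH ha, hx] at h1
  simp at h1

/-- Brackets with elements of the isotropy algebra act skew-symmetrically. -/
theorem inner_bracket_isotropy [CompleteSpace E] (hGH : IsHomogeneousManifold E V H)
    {a : SmoothRiemannianMetric V (G ⧸ H)} (ha : IsInvariantMetric a)
    {x : GroupLieAlgebra 𝓘(ℝ, E) G} (hx : projDifferential E V H x = 0)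
    (u v : GroupLieAlgebra 𝓘(ℝ, E) G) :
    a.inner (QuotientGroup.mk 1) (projDifferential E V H ⁅x, u⁆) (projDifferential E V H v)
      + a.inner (QuotientGroup.mk 1) (projDifferential E V H u) (projDifferential E V H ⁅x, v⁆)
      = 0 := by
  have := lieGroup_minSmoothness E G
  have : IsManifold 𝓘(ℝ, E) ∞ G :=
    (inferInstance : ContMDiffMul 𝓘(ℝ, E) ∞ G).toIsManifold
  have : IsManifold 𝓘(ℝ, E) 2 G := IsManifold.of_le (n := ∞) ENat.LEInfty.out
  have : IsManifold 𝓘(ℝ, E) 1 G := IsManifold.of_le (n := ∞) ENat.LEInfty.out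
  have : IsManifold 𝓘(ℝ, V) 1 (G ⧸ H) := IsManifold.of_le (n := ∞) ENat.LEInfty.out
  set o : G ⧸ H := QuotientGroup.mk 1
  set p₀ : E := extChartAt 𝓘(ℝ, E) (1 : G) 1
  let σ : E → G := (extChartAt 𝓘(ℝ, E) (1 : G)).symm
  let ψ : G ⧸ H → V := extChartAt 𝓘(ℝ, V) o
  let π : G → G ⧸ H := QuotientGroup.mk
  -- `P` is the projection in charts, and `U w` below is the left-invariant field of `w` in the
  -- chart at the identity.
  let P : E → V := fun p => ψ (π (σ p))
  let U : GroupLieAlgebra 𝓘(ℝ, E) G → E → E := fun w =>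
    mpullbackWithin 𝓘(ℝ, E) 𝓘(ℝ, E) σ (mulInvariantVectorField w) (Set.range 𝓘(ℝ, E))
  have hσ₀ : σ p₀ = 1 := extChartAt_to_inv (1 : G)
  have hσ : ContMDiffAt 𝓘(ℝ, E) 𝓘(ℝ, E) ∞ σ p₀ :=
    (contMDiffOn_extChartAt_symm (1 : G)).contMDiffAt
      (extChartAt_target_mem_nhds (1 : G))
  have hPm : ContMDiffAt 𝓘(ℝ, E) 𝓘(ℝ, V) ∞ P p₀ := by
    have h1 : ContMDiffAt 𝓘(ℝ, E) 𝓘(ℝ, V) ∞ (π ∘ σ) p₀ := (hGH.contMDiff_mk _).comp p₀ hσ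
    have h2 : ContMDiffAt 𝓘(ℝ, V) 𝓘(ℝ, V) ∞ ψ ((π ∘ σ) p₀) := by
      have : (π ∘ σ) p₀ = o := congrArg π hσ₀
      rw [this]
      exact contMDiffAt_extChartAt
    exact h2.comp p₀ h1
  have hP : ContDiffAt ℝ 2 P p₀ := hPm.contDiffAt.of_le ENat.LEInfty.out
  have hr : σ ⁻¹' Set.univ ∩ Set.range 𝓘(ℝ, E) = Set.univ := by simp
  have hU : ∀ w, DifferentiableAt ℝ (U w) p₀ := by
    intro w
    have := (mdifferentiableAt_mulInvariantVectorField (I := 𝓘(ℝ, E)) w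
      (g := (1 : G))).mdifferentiableWithinAt (s := Set.univ)
    have h : DifferentiableWithinAt ℝ (U w) (σ ⁻¹' Set.univ ∩ Set.range 𝓘(ℝ, E)) p₀ :=
      this.differentiableWithinAt_mpullbackWithin_vectorField
    rwa [hr, differentiableWithinAt_univ] at h
  have hdσ : ∀ p ∈ (extChartAt 𝓘(ℝ, E) (1 : G)).target, ∀ w,
      mfderiv 𝓘(ℝ, E) 𝓘(ℝ, E) σ p (U w p) = mulInvariantVectorField w (σ p) := by
    intro p hp w
    have hi := isInvertible_mfderivWithin_extChartAt_symm (I := 𝓘(ℝ, E)) hp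
    have h1 : mfderivWithin 𝓘(ℝ, E) 𝓘(ℝ, E) σ (Set.range 𝓘(ℝ, E)) p =
        mfderiv 𝓘(ℝ, E) 𝓘(ℝ, E) σ p := by
      rw [modelWithCornersSelf_coe, Set.range_id, mfderivWithin_univ]
    rw [← h1]
    exact hi.self_apply_inverse _
  have hchain : ∀ p ∈ (extChartAt 𝓘(ℝ, E) (1 : G)).target, π (σ p) ∈ (chartAt V o).source →
      ∀ z : E, fderiv ℝ P p z = mfderiv 𝓘(ℝ, V) 𝓘(ℝ, V) ψ (π (σ p))
        (mfderiv 𝓘(ℝ, E) 𝓘(ℝ, V) π (σ p) (mfderiv 𝓘(ℝ, E) 𝓘(ℝ, E) σ p z)) := by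
    intro p hp hp' z
    have h1 : MDifferentiableAt 𝓘(ℝ, E) 𝓘(ℝ, E) σ p :=
      ((contMDiffOn_extChartAt_symm (n := ∞) (1 : G)).contMDiffAt
        ((isOpen_extChartAt_target (1 : G)).mem_nhds hp)).mdifferentiableAt (by simp)
    have h2 := mdifferentiableAt_mk hGH (σ p)
    have h3 : MDifferentiableAt 𝓘(ℝ, V) 𝓘(ℝ, V) ψ (π (σ p)) := mdifferentiableAt_extChartAt hp'
    have h4 := mfderiv_comp p h2 h1
    have h5 := mfderiv_comp p (g := ψ) (f := π ∘ σ) h3 (h2.comp p h1)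
    rw [h4] at h5
    rw [← mfderiv_eq_fderiv]
    exact congrArg (fun T : E →L[ℝ] V => T z) h5
  have hnear : ∀ᶠ p in 𝓝 p₀, p ∈ (extChartAt 𝓘(ℝ, E) (1 : G)).target ∧
      π (σ p) ∈ (chartAt V o).source := by
    have h0 : ∀ᶠ p in 𝓝 p₀, p ∈ (extChartAt 𝓘(ℝ, E) (1 : G)).target :=
      extChartAt_target_mem_nhds (1 : G)
    refine h0.and ?_
    have h1 : ContinuousAt (π ∘ σ) p₀ := ((hGH.contMDiff_mk _).comp p₀ hσ).continuousAt
    have h2 : (chartAt V o).source ∈ 𝓝 ((π ∘ σ) p₀) := by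
      have : (π ∘ σ) p₀ = o := congrArg π hσ₀
      rw [this]
      exact (chartAt V o).open_source.mem_nhds (mem_chart_source V o)
    exact h1.preimage_mem_nhds h2
  obtain ⟨B, hB, hBa⟩ := exists_metric_in_chart a o
  have hP₀ : P p₀ = ψ o := congrArg (fun g => ψ (π g)) hσ₀
  have hdσ₀ : mfderiv 𝓘(ℝ, E) 𝓘(ℝ, E) σ p₀ = ContinuousLinearMap.id ℝ E := by
    have := mfderivWithin_range_extChartAt_symm (I := 𝓘(ℝ, E)) (x := (1 : G))
    rwa [modelWithCornersSelf_coe, Set.range_id, mfderivWithin_univ] at this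
  have hbase : ∀ z : E, fderiv ℝ P p₀ z = mfderiv 𝓘(ℝ, V) 𝓘(ℝ, V) ψ o
      (projDifferential E V H z) := by
    intro z
    have h2 : ∀ g : G, g = 1 → (mfderiv 𝓘(ℝ, V) 𝓘(ℝ, V) ψ (π g)
        (mfderiv 𝓘(ℝ, E) 𝓘(ℝ, V) π g z) : V) = mfderiv 𝓘(ℝ, V) 𝓘(ℝ, V) ψ o
          (projDifferential E V H z) := by
      rintro g rfl
      rfl
    rw [hchain p₀ hnear.self_of_nhds.1 hnear.self_of_nhds.2 z, hdσ₀]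
    exact h2 _ hσ₀
  have hval : ∀ w, U w p₀ = w := by
    intro w
    have h1 := hdσ p₀ hnear.self_of_nhds.1 w
    rw [hdσ₀] at h1
    have h2 : ∀ g : G, g = 1 → (mulInvariantVectorField w g : E) = w := by
      rintro g rfl
      have : (fun x : G => 1 * x) = id := by ext; simp
      rw [mulInvariantVectorField, this, mfderiv_id]
      rfl
    exact h1.trans (h2 _ hσ₀)
  -- The bracket on `𝔤` is defined through this chart, whose differential at the identity is the
  -- identity map.
  have hbr : ∀ w, lieBracket ℝ (U x) (U w) p₀ = ⁅x, w⁆ := by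
    intro w
    rw [GroupLieAlgebra.bracket_def, ← mlieBracketWithin_univ, mlieBracketWithin_apply,
      mfderiv_extChartAt_self]
    have : lieBracket ℝ (U x) (U w) p₀ =
        lieBracketWithin ℝ (U x) (U w) (σ ⁻¹' Set.univ ∩ Set.range 𝓘(ℝ, E)) p₀ := by
      rw [hr, lieBracketWithin_univ]
    have hid : ∀ z : E, (ContinuousLinearMap.id ℝ E).inverse z = z := by simp
    exact this.trans (hid _).symm
  have main := bilin_lieBracket_of_vertical (c := a.inner o (projDifferential E V H u)
      (projDifferential E V H v)) hP (hU x) (hU u) (hU v) (hnear.mono fun p hp => by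
        rw [hchain p hp.1 hp.2, hdσ p hp.1, mfderiv_mk_mulInvariantVectorField_eq_zero hGH ha _ hx]
        exact map_zero (mfderiv 𝓘(ℝ, V) 𝓘(ℝ, V) ψ (π (σ p)))) (B := B) (hP₀ ▸ hB)
      (hnear.mono fun p hp => by
        rw [hchain p hp.1 hp.2, hchain p hp.1 hp.2, hdσ p hp.1, hdσ p hp.1]
        exact (hBa _ hp.2 _ _).trans (inner_mulInvariantVectorField hGH ha _ u v))
  rw [hbase, hbase, hbase, hbase, hbr, hbr, hval, hval, hP₀] at main
  rwa [hBa o (mem_chart_source V o), hBa o (mem_chart_source V o)] at main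

end Isotropy

/-! ### Transport from `𝔪` to the tangent space at the base point. -/

section LinearPullback

variable {W V : Type*} [AddCommGroup W] [Module ℝ W] [AddCommGroup V] [Module ℝ V]

lemma fundamentalTensor_comp_linear (f : V → ℝ) (T : W →ₗ[ℝ] V) (y u v : W) :
    fundamentalTensor (fun w => f (T w)) y u v = fundamentalTensor f (T y) (T u) (T v) := by
  simp [fundamentalTensor]

lemma cartanTensor_comp_linear (f : V → ℝ) (T : W →ₗ[ℝ] V) (y z u v : W) :
    cartanTensor (fun w => f (T w)) y z u v = cartanTensor f (T y) (T z) (T u) (T v) := by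
  simp [cartanTensor]

end LinearPullback

namespace ReductiveDecomposition

variable {E : Type*} [NormedAddCommGroup E] [NormedSpace ℝ E]
  {V : Type*} [NormedAddCommGroup V] [NormedSpace ℝ V]
  {G : Type*} [Group G] [TopologicalSpace G] [ChartedSpace E G]
  {H : Subgroup G} [ChartedSpace V (G ⧸ H)]

/-- The identification of `𝔪` with the model space of the tangent space at the base point, as a
linear equivalence. -/
def tangentEquiv (hGH : IsHomogeneousManifold E V H) (D : ReductiveDecomposition E V H) :
    D.m ≃ₗ[ℝ] V :=
  LinearEquiv.ofBijective (M₂ := V) ((projDifferential E V H).domRestrict D.m) (by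
    constructor
    · intro u v huv
      have h : projDifferential E V H u = projDifferential E V H v := huv
      have h' : (u - v : GroupLieAlgebra 𝓘(ℝ, E) G) ∈ isotropyAlgebra E V H := by
        rw [isotropyAlgebra, LinearMap.mem_ker, map_sub, h, sub_self]
      exact Subtype.ext (sub_eq_zero.1
        (Submodule.disjoint_def.1 D.isCompl.disjoint _ (D.m.sub_mem u.2 v.2) h'))
    · intro w
      obtain ⟨z, hz⟩ := hGH.surjective_mfderiv_mk 1 w
      obtain ⟨y, hy, x, hx, hxy⟩ := Submodule.mem_sup.1
        (D.isCompl.sup_eq_top ▸ Submodule.mem_top : z ∈ D.m ⊔ isotropyAlgebra E V H)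
      refine ⟨⟨y, hy⟩, ?_⟩
      have hx' : projDifferential E V H x = 0 := hx
      have : projDifferential E V H z = projDifferential E V H y := by
        rw [← hxy, map_add, hx', add_zero]
      exact this.symm.trans hz)

lemma tangentEquiv_apply (hGH : IsHomogeneousManifold E V H) (D : ReductiveDecomposition E V H)
    (y : D.m) : D.tangentEquiv hGH y = D.toTangent y := rfl

/-- The discarded `𝔥`-component of the bracket lies in the kernel of the differential. -/
lemma toTangent_bracketM (D : ReductiveDecomposition E V H) (x y : GroupLieAlgebra 𝓘(ℝ, E) G) :
    D.toTangent (D.bracketM x y) = projDifferential E V H ⁅x, y⁆ := by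
  have h : ⁅x, y⁆ - (D.bracketM x y : GroupLieAlgebra 𝓘(ℝ, E) G) ∈ isotropyAlgebra E V H := by
    rw [← Submodule.ker_projectionOnto D.isCompl, LinearMap.mem_ker, map_sub, bracketM,
      Submodule.projectionOnto_apply_left, sub_self]
  have h' : projDifferential E V H _ = 0 := h
  rw [map_sub] at h'
  exact (sub_eq_zero.1 h').symm

/-- The endomorphism `(ad_x)_𝔪`, transported to the tangent space at the base point. -/
def adTangent [LieGroup 𝓘(ℝ, E) (minSmoothness ℝ 3) G] [CompleteSpace E]
    (hGH : IsHomogeneousManifold E V H) (D : ReductiveDecomposition E V H)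
    (x : GroupLieAlgebra 𝓘(ℝ, E) G) : V →ₗ[ℝ] V :=
  (projDifferential E V H : GroupLieAlgebra 𝓘(ℝ, E) G →ₗ[ℝ] V) ∘ₗ
    (LieAlgebra.ad ℝ (GroupLieAlgebra 𝓘(ℝ, E) G) x) ∘ₗ D.m.subtype ∘ₗ
      (D.tangentEquiv hGH).symm.toLinearMap

lemma adTangent_toTangent [LieGroup 𝓘(ℝ, E) (minSmoothness ℝ 3) G] [CompleteSpace E]
    (hGH : IsHomogeneousManifold E V H) (D : ReductiveDecomposition E V H)
    (x : GroupLieAlgebra 𝓘(ℝ, E) G) (y : D.m) :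
    D.adTangent hGH x (D.toTangent y) = D.toTangent (D.bracketM x y) := by
  rw [toTangent_bracketM, ← tangentEquiv_apply hGH]
  change projDifferential E V H ⁅x, (((D.tangentEquiv hGH).symm (D.tangentEquiv hGH y) : D.m) :
    GroupLieAlgebra 𝓘(ℝ, E) G)⁆ = _
  rw [LinearEquiv.symm_apply_apply]

end ReductiveDecomposition

/-! ### The two implications. -/

theorem mainTheorem2
    {E : Type*} [NormedAddCommGroup E] [NormedSpace ℝ E] [FiniteDimensional ℝ E]
    {V : Type*} [NormedAddCommGroup V] [NormedSpace ℝ V] [FiniteDimensional ℝ V]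
    {G : Type*} [Group G] [TopologicalSpace G] [ChartedSpace E G] [LieGroup 𝓘(ℝ, E) ∞ G]
    (H : Subgroup G) (_hH : IsClosed (H : Set G))
    [ChartedSpace V (G ⧸ H)] [IsManifold 𝓘(ℝ, V) ∞ (G ⧸ H)]
    (_hGH : IsHomogeneousManifold E V H)
    (φ : ℝ → ℝ) (b₀ : ℝ) (_hφ : IsAlphaBetaProfile φ b₀)
    (a : SmoothRiemannianMetric V (G ⧸ H)) (_ha : IsInvariantMetric a)
    (X : (x : G ⧸ H) → TangentSpace 𝓘(ℝ, V) x)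
    (_hXs : ContMDiff 𝓘(ℝ, V) 𝓘(ℝ, V).tangent ∞
      (fun x : G ⧸ H => (⟨x, X x⟩ : TangentBundle 𝓘(ℝ, V) (G ⧸ H))))
    (_hX : IsInvariantField X)
    (_hXb : ∀ x : G ⧸ H, √(a.inner x (X x) (X x)) < b₀)
    (D : ReductiveDecomposition E V H) :
    (D.AdSkewAdjoint a → D.OrthogonalToBrackets a X →
      D.NaturallyReductive (alphaBetaMetric φ a X) ∧
        IsNaturallyReductive E (alphaBetaMetric φ a X)) ∧
    (D.NaturallyReductive (alphaBetaMetric φ a X) →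
      ChernEqLeviCivita (alphaBetaMetric φ a X) a →
      (∀ y : D.m, y ≠ 0 →
        deriv φ (alphaBetaRatio a X (QuotientGroup.mk (1 : G)) (D.toTangent y)) ≠ 0) →
      D.AdSkewAdjoint a ∧ D.OrthogonalToBrackets a X) := by
  have := lieGroup_minSmoothness E G
  have : CompleteSpace E := FiniteDimensional.complete ℝ E
  let T : D.m ≃ₗ[ℝ] V := D.tangentEquiv _hGH
  let q : V →L[ℝ] V →L[ℝ] ℝ := a.inner (QuotientGroup.mk 1)
  let ξ : V := X (QuotientGroup.mk 1)
  have hs : ∀ u v, q u v = q v u := a.symm _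
  have hp : ∀ v, v ≠ 0 → 0 < q v v := a.pos _
  have hb : √(q ξ ξ) < b₀ := _hXb _
  have hg : ∀ y u v : D.m, fundamentalTensor (D.inducedNorm (alphaBetaMetric φ a X)) y u v =
      fundamentalTensor (alphaBetaNorm q ξ φ) (T y) (T u) (T v) := fun y u v =>
    fundamentalTensor_comp_linear (alphaBetaNorm q ξ φ) T.toLinearMap y u v
  have hC : ∀ y z u v : D.m, cartanTensor (D.inducedNorm (alphaBetaMetric φ a X)) y z u v =
      cartanTensor (alphaBetaNorm q ξ φ) (T y) (T z) (T u) (T v) := fun y z u v =>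
    cartanTensor_comp_linear (alphaBetaNorm q ξ φ) T.toLinearMap y z u v
  have hA : ∀ (x : GroupLieAlgebra 𝓘(ℝ, E) G) (y : D.m),
      T (D.bracketM x y) = D.adTangent _hGH x (T y) := fun x y =>
    (D.adTangent_toTangent _hGH x y).symm
  refine ⟨fun hskew horth => ?_, fun hnat _ hφ' => ?_⟩
  · have hD : D.NaturallyReductive (alphaBetaMetric φ a X) := by
      intro y x u v hy
      rw [hg, hg, hC, hA, hA, hA]
      refine alphaBetaNorm_infinitesimally_invariant _hφ hs hp hb _ (fun w => ?_) (fun w => ?_)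
        (by simpa using hy) _ _
      · obtain ⟨w, rfl⟩ := T.surjective w
        have h : q (T (D.bracketM x w)) (T w) = -q (T w) (T (D.bracketM x w)) := hskew x w w
        rw [hs, hA] at h
        linarith
      · obtain ⟨w, rfl⟩ := T.surjective w
        rw [← hA]
        exact horth x w
    exact ⟨hD, D, hD⟩
  · have key : ∀ x : D.m, (∀ y, q y (D.adTangent _hGH x y) = 0) ∧
        ∀ y, q ξ (D.adTangent _hGH x y) = 0 := by
      intro x
      refine skew_of_alphaBetaNorm_infinitesimally_invariant _hφ hs hp hb _
        (fun y hy u v => ?_) (fun y hy => ?_)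
      · obtain ⟨y, rfl⟩ := T.surjective y
        obtain ⟨u, rfl⟩ := T.surjective u
        obtain ⟨v, rfl⟩ := T.surjective v
        have h := hnat y x u v (by simpa using hy)
        rwa [hg, hg, hC, hA, hA, hA] at h
      · obtain ⟨y, rfl⟩ := T.surjective y
        exact hφ' y (by simpa using hy)
    refine ⟨fun x u v => ?_, fun u v => ?_⟩
    · change q (T (D.bracketM x u)) (T v) = -q (T u) (T (D.bracketM x v))
      -- Split `x` into its `𝔪`-part `y`, governed by natural reductivity, and its `𝔥`-part `z`,
      -- governed by invariance of `a`.
      obtain ⟨y, hy, z, hz, rfl⟩ := Submodule.mem_sup.1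
        (D.isCompl.sup_eq_top ▸ Submodule.mem_top : x ∈ D.m ⊔ isotropyAlgebra E V H)
      have hz' : q (T (D.bracketM z u)) (T v) + q (T u) (T (D.bracketM z v)) = 0 := by
        have h := inner_bracket_isotropy _hGH _ha (x := z) hz u v
        rwa [← D.toTangent_bracketM, ← D.toTangent_bracketM] at h
      have hadd : ∀ w : D.m, T (D.bracketM (y + z) w) =
          T (D.bracketM y w) + T (D.bracketM z w) := by
        intro w
        rw [← map_add]
        simp only [ReductiveDecomposition.bracketM, add_lie, map_add]
      have hy' : q (T (D.bracketM y u)) (T v) + q (T u) (T (D.bracketM y v)) = 0 := by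
        have h0 : ∀ w : D.m, q (T w) (T (D.bracketM y w)) = 0 := fun w => by
          rw [hA]
          exact (key ⟨y, hy⟩).1 _
        -- Polarization of `q w (A w) = 0`.
        have h := (key ⟨y, hy⟩).1 (T u + T v)
        simp only [map_add, add_apply, ← hA, h0] at h
        rw [hs _ (T v)]
        linarith
      rw [hadd, hadd]
      simp only [map_add, add_apply]
      linarith
    · change q ξ (T (D.bracketM u v)) = 0
      rw [hA]
      exact (key u).2 _

end
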